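/- A topos means an elementary topos: a category with finite limits that is cartesian closed and has a subobject classifier. For a functor $L\colon \mathbf A\to\mathbf X$, let ${}_L\mathbf{StrCsp}$ be the category whose objects are cospans $La\xrightarrow{m}x\xleftarrow{n}Lb$ in $\mathbf X$ and whose morphisms to $Lc\xrightarrow{o}y\xleftarrow{p}Ld$ are triples $(f\colon a\to c,\ g\colon x\to y,\ h\colon b\to d)$ with $gm=o\,L(f)$ and $gn=p\,L(h)$. Let $\mathbf{AdjTopos}$ be the category whose objects are topoi and whose morphisms $\mathbf A\to\mathbf A'$ are adjunctions $F\dashv G$ with $F\colon\mathbf A'\to\mathbf A$ preserving pullbacks and $G\colon\mathbf A\to\mathbf A'$ (the direction is that of the right adjoint). Let $[\bullet\to\bullet,\mathbf{AdjTopos}]$ be the category whose objects are adjunctions $L\dashv R$ between topoi, with $L\colon\mathbf A\to\mathbf X$ preserving pullbacks, and whose morphisms from $L\dashv R$ to $L'\dashv R'$ (with $L'\colon\mathbf A'\to\mathbf X'$) are pairs of morphisms of $\mathbf{AdjTopos}$, $F\dashv G$ (with $G\colon\mathbf A\to\mathbf A'$) and $F'\dashv G'$ (with $G'\colon\mathbf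 X\to\mathbf X'$), such that $LF=F'L'$ and $GR=R'G'$. **Theorem.** There is a functor $${}_{(-)}\mathbf{StrCsp}\colon[\bullet\to\bullet,\mathbf{AdjTopos}]\to\mathbf{AdjTopos}$$ which sends $L\dashv R$ to ${}_L\mathbf{StrCsp}$ (in particular this is a topos) and sends a morphism $(F\dashv G,\ F'\dashv G')$ from $L\dashv R$ to $L'\dashv R'$ to an adjunction $\Theta'\dashv\Theta$ with $\Theta\colon{}_L\mathbf{StrCsp}\to{}_{L'}\mathbf{StrCsp}$ and $\Theta'\colon{}_{L'}\mathbf{StrCsp}\to{}_L\mathbf{StrCsp}$, whose left adjoint $\Theta'$ preserves pullbacks. These are given as follows. * $\Theta$ sends $La\xrightarrow{m}x\xleftarrow{n}Lb$ to $L'Ga\xrightarrow{G'(m)\,\kappa_a}G'x\xleftarrow{G'(n)\,\kappa_b}L'Gb$ and $(f,g,h)$ to $(Gf,G'g,Gh)$, where $\kappa\colon L'G\Rightarrow G'L$ is the canonical comparison (the mate of the equality $F'L'=LF$): $\kappa_a$ is the transpose under $F'\dashv G'$ of $F'L'Ga=LFGa\xrightarrow{L\varepsilon_a}La$, with $\varepsilon$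 the counit of $F\dashv G$. * $\Theta'$ sends $L'a'\xrightarrow{m'}x'\xleftarrow{n'}L'b'$ to $LFa'=F'L'a'\xrightarrow{F'm'}F'x'\xleftarrow{F'n'}F'L'b'=LFb'$ and $(f',g',h')$ to $(Ff',F'g',Fh')$. * The bijection $\hom(\Theta'\ell',\ell)\cong\hom(\ell',\Theta\ell)$ is componentwise: it sends $(f,g,h)$ to the triple of the transposes of $f$ and $h$ under $F\dashv G$ and of $g$ under $F'\dashv G'$. The same assignments also define a functor on the category of all commutative squares of $\mathbf{AdjTopos}$ (where composite adjunctions are required to agree including their units). -/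

import Mathlib

open CategoryTheory CategoryTheory.Limits

-- Tried before the (definitionally equal) quiver that comes from reflexive quivers.
attribute [local instance 2000] CategoryStruct.toQuiver

universe v u v₁ u₁ v₂ u₂ v₃ u₃ v₄ u₄

/-- An elementary topos: finite limits, exponentials (cartesian closedness) and a
subobject classifier. -/
structure IsElementaryTopos (C : Type u) [Category.{v} C] : Prop where
  hasFiniteLimits : HasFiniteLimits C
  cartesianClosed : ∀ X : C, (prod.functor.obj X).IsLeftAdjoint
  hasClassifier : HasSubobjectClassifier C

/-! ### The category of topoi and adjunctions -/

/-- A bundled elementary topos. Morphisms are adjunctions, see `AdjTopos.Hom`. The objects live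
in `Type (max u v)`, so small (`u = v`) and large, locally small (`u = v + 1`) topoi are both
covered. -/
structure AdjTopos : Type (max (u + 1) (v + 1)) where
  carrier : Type (max u v)
  [cat : Category.{v} carrier]
  isTopos : IsElementaryTopos carrier

namespace AdjTopos

attribute [instance] AdjTopos.cat

/-- A morphism `A ⟶ B`: an adjunction `left ⊣ right` with `left : B ⥤ A` pullback preserving and
`right : A ⥤ B`. As for geometric morphisms, the direction is that of the right adjoint. -/
structure Hom (A B : AdjTopos.{v, u}) where
  left : B.carrier ⥤ A.carrier
  right : A.carrier ⥤ B.carrier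
  adj : left ⊣ right
  preservesPullbacks : PreservesLimitsOfShape WalkingCospan left

/-- Identities and composites are those of adjunctions. -/
instance : Category AdjTopos.{v, u} where
  Hom := Hom
  id A :=
    { left := 𝟭 A.carrier
      right := 𝟭 A.carrier
      adj := Adjunction.id
      preservesPullbacks := inferInstance }
  comp f g :=
    { left := g.left ⋙ f.left
      right := f.right ⋙ g.right
      adj := g.adj.comp f.adj
      preservesPullbacks :=
        haveI := f.preservesPullbacks
        haveI := g.preservesPullbacks
        inferInstance }
  id_comp f := by
    rcases f with ⟨l, r, adj, p⟩
    congr 1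
    ext
    simp
  comp_id f := by
    rcases f with ⟨l, r, adj, p⟩
    congr 1
    ext
    simp
  assoc f g h := by
    rcases f with ⟨l, r, adj, p⟩
    rcases g with ⟨l', r', adj', p'⟩
    rcases h with ⟨l'', r'', adj'', p''⟩
    congr 1
    ext
    simp

end AdjTopos

/-! ### The arrow category of `AdjTopos` -/

/-- An adjunction `L ⊣ R` between topoi, `L : A ⥤ X` pullback preserving. -/
structure ToposAdj : Type (max (u + 1) (v + 1)) where
  A : AdjTopos.{v, u}
  X : AdjTopos.{v, u}
  hom : X ⟶ A

namespace ToposAdj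

/-- The left adjoint `L : A ⥤ X`. -/
abbrev L (S : ToposAdj.{v, u}) : S.A.carrier ⥤ S.X.carrier := AdjTopos.Hom.left S.hom

/-- The right adjoint `R : X ⥤ A`. -/
abbrev R (S : ToposAdj.{v, u}) : S.X.carrier ⥤ S.A.carrier := AdjTopos.Hom.right S.hom

/-- A morphism from `L ⊣ R` to `L' ⊣ R'`: adjunctions `F ⊣ G` (with `G : A ⥤ A'`) and
`F' ⊣ G'` (with `G' : X ⥤ X'`) such that `L F = F' L'` and `G R = R' G'`. -/
@[ext]
structure Hom (S T : ToposAdj.{v, u}) where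
  homA : S.A ⟶ T.A
  homX : S.X ⟶ T.X
  left_comm : AdjTopos.Hom.left homA ⋙ S.L = T.L ⋙ AdjTopos.Hom.left homX
  right_comm : S.R ⋙ AdjTopos.Hom.right homA = AdjTopos.Hom.right homX ⋙ T.R

namespace Hom

variable {S T : ToposAdj.{v, u}} (σ : Hom S T)

/-- `F : A' ⥤ A` -/
abbrev F : T.A.carrier ⥤ S.A.carrier := AdjTopos.Hom.left σ.homA

/-- `G : A ⥤ A'` -/
abbrev G : S.A.carrier ⥤ T.A.carrier := AdjTopos.Hom.right σ.homA

/-- `F ⊣ G` -/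
abbrev adjA : σ.F ⊣ σ.G := AdjTopos.Hom.adj σ.homA

/-- `F' : X' ⥤ X` -/
abbrev F' : T.X.carrier ⥤ S.X.carrier := AdjTopos.Hom.left σ.homX

/-- `G' : X ⥤ X'` -/
abbrev G' : S.X.carrier ⥤ T.X.carrier := AdjTopos.Hom.right σ.homX

/-- `F' ⊣ G'` -/
abbrev adjX : σ.F' ⊣ σ.G' := AdjTopos.Hom.adj σ.homX

end Hom

instance : Category ToposAdj.{v, u} where
  Hom := Hom
  id S := ⟨𝟙 S.A, 𝟙 S.X, rfl, rfl⟩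
  comp σ τ :=
    { homA := σ.homA ≫ τ.homA
      homX := σ.homX ≫ τ.homX
      left_comm :=
        (congrArg (fun K => τ.F ⋙ K) σ.left_comm).trans
          (congrArg (fun K => K ⋙ σ.F') τ.left_comm)
      right_comm :=
        (congrArg (fun K => K ⋙ τ.G) σ.right_comm).trans
          (congrArg (fun K => σ.G' ⋙ K) τ.right_comm) }
  id_comp σ := Hom.ext (Category.id_comp σ.homA) (Category.id_comp σ.homX)
  comp_id σ := Hom.ext (Category.comp_id σ.homA) (Category.comp_id σ.homX)
  assoc σ τ ρ :=
    Hom.ext (Category.assoc σ.homA τ.homA ρ.homA) (Category.assoc σ.homX τ.homX ρ.homX)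

/-- Mathlib's arrow category of `AdjTopos`, whose squares commute as squares of adjunctions
(units included), maps to `ToposAdj`, whose squares are only asked to commute for the left
adjoints and for the right adjoints. It is the identity on objects and on pairs of adjunctions. -/
def ofArrow : Arrow AdjTopos.{v, u} ⥤ ToposAdj.{v, u} where
  obj f := ⟨f.right, f.left, f.hom⟩
  map {f g} s :=
    { homA := s.right
      homX := s.left
      left_comm := (congrArg AdjTopos.Hom.left s.w).symm
      right_comm := (congrArg AdjTopos.Hom.right s.w).symm }

end ToposAdj

/-! ### Structured cospans -/

section StrCsp

variable {A : Type u₁} [Category.{v₁} A] {X : Type u₂} [Category.{v₂} X]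

/-- An `L`-structured cospan `L a ⟶ x ⟵ L b`. -/
structure StrCsp (L : A ⥤ X) where
  a : A
  x : X
  b : A
  m : L.obj a ⟶ x
  n : L.obj b ⟶ x

namespace StrCsp

/-- A morphism `(f, g, h)` of structured cospans. -/
@[ext]
structure Hom {L : A ⥤ X} (p q : StrCsp L) where
  f : p.a ⟶ q.a
  g : p.x ⟶ q.x
  h : p.b ⟶ q.b
  comm_m : p.m ≫ g = L.map f ≫ q.m
  comm_n : p.n ≫ g = L.map h ≫ q.n

/-- The category of `L`-structured cospans, with componentwise composition. -/
instance (L : A ⥤ X) : Category (StrCsp L) where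
  Hom := Hom
  id p := ⟨𝟙 _, 𝟙 _, 𝟙 _, by simp, by simp⟩
  comp s t :=
    { f := s.f ≫ t.f
      g := s.g ≫ t.g
      h := s.h ≫ t.h
      comm_m := by
        rw [← Category.assoc, s.comm_m, Category.assoc, t.comm_m, L.map_comp, Category.assoc]
      comm_n := by
        rw [← Category.assoc, s.comm_n, Category.assoc, t.comm_n, L.map_comp, Category.assoc] }
  id_comp s := Hom.ext (Category.id_comp s.f) (Category.id_comp s.g) (Category.id_comp s.h)
  comp_id s := Hom.ext (Category.comp_id s.f) (Category.comp_id s.g) (Category.comp_id s.h)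
  assoc s t r :=
    Hom.ext (Category.assoc s.f t.f r.f) (Category.assoc s.g t.g r.g) (Category.assoc s.h t.h r.h)

/-- Functors `P : A ⥤ B`, `Q : X ⥤ Y` and a transformation `α : P K ⟶ L Q` send a structured
cospan `L a ⟶ x ⟵ L b` to `K P a ⟶ Q L a ⟶ Q x ⟵ Q L b ⟵ K P b`, and a morphism `(f, g, h)` to
`(P f, Q g, P h)`. -/
@[simps]
def push {B : Type u₃} [Category.{v₃} B] {Y : Type u₄} [Category.{v₄} Y]
    {L : A ⥤ X} {K : B ⥤ Y} (P : A ⥤ B) (Q : X ⥤ Y) (α : P ⋙ K ⟶ L ⋙ Q) :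
    StrCsp L ⥤ StrCsp K where
  obj p :=
    { a := P.obj p.a
      x := Q.obj p.x
      b := P.obj p.b
      m := α.app p.a ≫ Q.map p.m
      n := α.app p.b ≫ Q.map p.n }
  map {p q} s :=
    { f := P.map s.f
      g := Q.map s.g
      h := P.map s.h
      comm_m := by
        have := α.naturality s.f
        simp only [Functor.comp_obj, Functor.comp_map] at this
        rw [Category.assoc, ← Q.map_comp, s.comm_m, Q.map_comp, reassoc_of% this]
      comm_n := by
        have := α.naturality s.h
        simp only [Functor.comp_obj, Functor.comp_map] at this
        rw [Category.assoc, ← Q.map_comp, s.comm_n, Q.map_comp, reassoc_of% this] }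
  map_id p := Hom.ext (P.map_id p.a) (Q.map_id p.x) (P.map_id p.b)
  map_comp s t := Hom.ext (P.map_comp s.f t.f) (Q.map_comp s.g t.g) (P.map_comp s.h t.h)

end StrCsp

end StrCsp

namespace ToposAdj.Hom

variable {S T : ToposAdj.{v, u}} (σ : ToposAdj.Hom S T)

/-- The canonical comparison `L' G ⟶ G' L`, the mate of the equality `F' L' = L F`. -/
def comparison : σ.G ⋙ T.L ⟶ S.L ⋙ σ.G' where
  app a := σ.adjX.homEquiv (T.L.obj (σ.G.obj a)) (S.L.obj a)
    (eqToHom (Functor.congr_obj σ.left_comm (σ.G.obj a)).symm ≫ S.L.map (σ.adjA.counit.app a))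
  naturality a b k := by
    have h := Functor.congr_hom σ.left_comm (σ.G.map k)
    have e := σ.adjA.counit.naturality k
    simp only [Functor.comp_obj, Functor.comp_map, Functor.id_map, Functor.id_obj] at h e ⊢
    rw [← Adjunction.homEquiv_naturality_right, ← Adjunction.homEquiv_naturality_left,
      Category.assoc, ← S.L.map_comp, ← e, S.L.map_comp, h]
    simp

/-- `Θ` sends `m : L a ⟶ x`, `n : L b ⟶ x` to the composites `L' G a ⟶ G' L a ⟶ G' x` and
`L' G b ⟶ G' L b ⟶ G' x` of the canonical comparison with `G' m` and `G' n`, and a morphism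
`(f, g, h)` to `(G f, G' g, G h)`. -/
abbrev Theta : StrCsp S.L ⥤ StrCsp T.L := StrCsp.push σ.G σ.G' σ.comparison

/-- `Θ'` sends `m' : L' a' ⟶ x'`, `n' : L' b' ⟶ x'` to `L F a' = F' L' a' ⟶ F' x'` and
`L F b' = F' L' b' ⟶ F' x'`, given by `F' m'` and `F' n'`, and a morphism `(f', g', h')` to
`(F f', F' g', F h')`. -/
abbrev Theta' : StrCsp T.L ⥤ StrCsp S.L := StrCsp.push σ.F σ.F' (eqToHom σ.left_comm)

end ToposAdj.Hom

/-! Under `L ⊣ R` a structured cospan `L a ⟶ x ⟵ L b` is a pair of maps `a ⟶ R x ⟵ b`, so the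
category glues `X` to two copies of `A`, and its topos structure can be built one leg at a time.
Limits are componentwise: the leg from `L (lim a)` is induced by the universal property of the apex
limit. Exponentials and the subobject classifier have the apex they have in `X`, while each foot is
a finite limit in `A` cutting out the data compatible with the apex (`exists_exponential_leg`,
`exists_classifier_leg`).

For `Θ' ⊣ Θ`, the comparison is the mate of `F' L' = L F`, so a triple satisfies the equations of a
morphism exactly when its triple of transposes does (`transpose_comm_iff`). Since limits are
componentwise, `Θ'` preserves pullbacks because `F` and `F'` do.

Functoriality is strict. Mates paste (`comparison_comp`), which gives equality of the functors; the
adjunctions then agree because their units do, and these are componentwise. Squares commuting in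
`AdjTopos` are handled by composing with `ofArrow`. -/

namespace StrCsp

/-! ### Limits of structured cospans are computed componentwise -/

section Limits

variable {A : Type u₁} [Category.{v₁} A] {X : Type u₂} [Category.{v₂} X] (L : A ⥤ X)

/-- The left foot of a structured cospan. -/
abbrev leftFoot : StrCsp L ⥤ A where
  obj p := p.a
  map s := s.f

/-- The apex of a structured cospan. -/
abbrev apex : StrCsp L ⥤ X where
  obj p := p.x
  map s := s.g

/-- The right foot of a structured cospan. -/
abbrev rightFoot : StrCsp L ⥤ A where
  obj p := p.b
  map s := s.h

variable {L}

@[ext]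
lemma hom_ext {p q : StrCsp L} {s t : p ⟶ q} (hf : s.f = t.f) (hg : s.g = t.g)
    (hh : s.h = t.h) : s = t :=
  Hom.ext hf hg hh


section

variable {p q r : StrCsp L} (s : p ⟶ q) (t : q ⟶ r)

@[simp] lemma comp_f : Hom.f (s ≫ t) = s.f ≫ t.f := rfl
@[simp] lemma comp_g : Hom.g (s ≫ t) = s.g ≫ t.g := rfl
@[simp] lemma comp_h : Hom.h (s ≫ t) = s.h ≫ t.h := rfl

end

variable {J : Type u₃} [Category.{v₃} J] {D : J ⥤ StrCsp L}

/-- A cone of structured cospans is a limit cone if its three components are. -/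
def isLimitOfComponents (c : Cone D) (ha : IsLimit ((leftFoot L).mapCone c))
    (hx : IsLimit ((apex L).mapCone c)) (hb : IsLimit ((rightFoot L).mapCone c)) :
    IsLimit c where
  lift s :=
    { f := ha.lift ((leftFoot L).mapCone s)
      g := hx.lift ((apex L).mapCone s)
      h := hb.lift ((rightFoot L).mapCone s)
      comm_m := hx.hom_ext fun j => by
        have h₁ : hx.lift ((apex L).mapCone s) ≫ (c.π.app j).g = (s.π.app j).g := hx.fac _ j
        have h₂ : ha.lift ((leftFoot L).mapCone s) ≫ (c.π.app j).f = (s.π.app j).f := ha.fac _ j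
        change (s.pt.m ≫ _) ≫ (c.π.app j).g = (_ ≫ c.pt.m) ≫ (c.π.app j).g
        have h₃ : s.pt.m ≫ (s.π.app j).g = L.map (s.π.app j).f ≫ (D.obj j).m :=
          (s.π.app j).comm_m
        have h₄ : c.pt.m ≫ (c.π.app j).g = L.map (c.π.app j).f ≫ (D.obj j).m :=
          (c.π.app j).comm_m
        rw [Category.assoc, Category.assoc, h₁, h₃, h₄,
          ← L.map_comp_assoc, h₂]
      comm_n := hx.hom_ext fun j => by
        have h₁ : hx.lift ((apex L).mapCone s) ≫ (c.π.app j).g = (s.π.app j).g := hx.fac _ j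
        have h₂ : hb.lift ((rightFoot L).mapCone s) ≫ (c.π.app j).h = (s.π.app j).h := hb.fac _ j
        change (s.pt.n ≫ _) ≫ (c.π.app j).g = (_ ≫ c.pt.n) ≫ (c.π.app j).g
        have h₃ : s.pt.n ≫ (s.π.app j).g = L.map (s.π.app j).h ≫ (D.obj j).n :=
          (s.π.app j).comm_n
        have h₄ : c.pt.n ≫ (c.π.app j).g = L.map (c.π.app j).h ≫ (D.obj j).n :=
          (c.π.app j).comm_n
        rw [Category.assoc, Category.assoc, h₁, h₃, h₄,
          ← L.map_comp_assoc, h₂] }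
  fac s j := hom_ext (ha.fac ((leftFoot L).mapCone s) j) (hx.fac ((apex L).mapCone s) j)
    (hb.fac ((rightFoot L).mapCone s) j)
  uniq s l hl := hom_ext
    (ha.uniq ((leftFoot L).mapCone s) l.f fun j => congrArg Hom.f (hl j))
    (hx.uniq ((apex L).mapCone s) l.g fun j => congrArg Hom.g (hl j))
    (hb.uniq ((rightFoot L).mapCone s) l.h fun j => congrArg Hom.h (hl j))

/-- A limit cone of the apices and cones of the feet combine to a cone of structured cospans. -/
def coneOfComponents (ca : Cone (D ⋙ leftFoot L)) {cx : Cone (D ⋙ apex L)} (hx : IsLimit cx)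
    (cb : Cone (D ⋙ rightFoot L)) : Cone D where
  pt :=
    { a := ca.pt
      x := cx.pt
      b := cb.pt
      m := hx.lift ⟨L.obj ca.pt,
        { app := fun j => L.map (ca.π.app j) ≫ (D.obj j).m
          naturality := fun i j k => by
            have : ca.π.app i ≫ (D.map k).f = ca.π.app j := ca.w k
            change 𝟙 _ ≫ L.map (ca.π.app j) ≫ (D.obj j).m =
              (L.map (ca.π.app i) ≫ (D.obj i).m) ≫ (D.map k).g
            rw [Category.id_comp, Category.assoc, (D.map k).comm_m, ← L.map_comp_assoc, this] }⟩
      n := hx.lift ⟨L.obj cb.pt,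
        { app := fun j => L.map (cb.π.app j) ≫ (D.obj j).n
          naturality := fun i j k => by
            have : cb.π.app i ≫ (D.map k).h = cb.π.app j := cb.w k
            change 𝟙 _ ≫ L.map (cb.π.app j) ≫ (D.obj j).n =
              (L.map (cb.π.app i) ≫ (D.obj i).n) ≫ (D.map k).g
            rw [Category.id_comp, Category.assoc, (D.map k).comm_n, ← L.map_comp_assoc, this] }⟩ }
  π :=
    { app := fun j =>
        { f := ca.π.app j
          g := cx.π.app j
          h := cb.π.app j
          comm_m := hx.fac _ j
          comm_n := hx.fac _ j }
      naturality := fun i j k =>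
        hom_ext (ca.π.naturality k) (cx.π.naturality k) (cb.π.naturality k) }

/-- Componentwise limits are limits. -/
def isLimitConeOfComponents {ca : Cone (D ⋙ leftFoot L)} (ha : IsLimit ca)
    {cx : Cone (D ⋙ apex L)} (hx : IsLimit cx) {cb : Cone (D ⋙ rightFoot L)} (hb : IsLimit cb) :
    IsLimit (coneOfComponents ca hx cb) :=
  isLimitOfComponents _ ha hx hb

variable [HasLimitsOfShape J A] [HasLimitsOfShape J X]

instance : HasLimitsOfShape J (StrCsp L) where
  has_limit D := ⟨⟨_, isLimitConeOfComponents (limit.isLimit (D ⋙ leftFoot L))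
    (limit.isLimit (D ⋙ apex L)) (limit.isLimit (D ⋙ rightFoot L))⟩⟩

/-- The componentwise cone is a limit cone, so the three projections preserve limits; this carries
arbitrary limit cones, monomorphisms and pullback squares to their components. -/
instance : PreservesLimitsOfShape J (leftFoot L) where
  preservesLimit {D} := preservesLimit_of_preserves_limit_cone
    (isLimitConeOfComponents (limit.isLimit (D ⋙ leftFoot L))
      (limit.isLimit (D ⋙ apex L)) (limit.isLimit (D ⋙ rightFoot L)))
    (limit.isLimit (D ⋙ leftFoot L))

instance : PreservesLimitsOfShape J (apex L) where
  preservesLimit {D} := preservesLimit_of_preserves_limit_cone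
    (isLimitConeOfComponents (limit.isLimit (D ⋙ leftFoot L))
      (limit.isLimit (D ⋙ apex L)) (limit.isLimit (D ⋙ rightFoot L)))
    (limit.isLimit (D ⋙ apex L))

instance : PreservesLimitsOfShape J (rightFoot L) where
  preservesLimit {D} := preservesLimit_of_preserves_limit_cone
    (isLimitConeOfComponents (limit.isLimit (D ⋙ leftFoot L))
      (limit.isLimit (D ⋙ apex L)) (limit.isLimit (D ⋙ rightFoot L)))
    (limit.isLimit (D ⋙ rightFoot L))

/-- `push` preserves the limits that its two functors preserve. -/
lemma push_preservesLimitsOfShape {B : Type*} [Category B] {Y : Type*} [Category Y]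
    {K : B ⥤ Y} (P : A ⥤ B) (Q : X ⥤ Y) (α : P ⋙ K ⟶ L ⋙ Q)
    [PreservesLimitsOfShape J P] [PreservesLimitsOfShape J Q] :
    PreservesLimitsOfShape J (push P Q α) where
  -- The components of the image cone are by definition the images under `P`, `Q`, `P` of the
  -- components of the given cone.
  preservesLimit := ⟨fun hc => ⟨isLimitOfComponents _
    (isLimitOfPreserves P (isLimitOfPreserves (leftFoot L) hc))
    (isLimitOfPreserves Q (isLimitOfPreserves (apex L) hc))
    (isLimitOfPreserves P (isLimitOfPreserves (rightFoot L) hc))⟩⟩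

end Limits

end StrCsp

namespace ToposAdj.Hom

/-! ### The adjunction `Θ' ⊣ Θ` -/

section Adjunction

variable {S T : ToposAdj.{v, u}} (σ : ToposAdj.Hom S T)

lemma comparison_app_eq (a : S.A.carrier) :
    σ.comparison.app a = σ.adjX.homEquiv (T.L.obj (σ.G.obj a)) (S.L.obj a)
      (eqToHom (Functor.congr_obj σ.left_comm (σ.G.obj a)).symm ≫
        S.L.map (σ.adjA.counit.app a)) := rfl

/-- Compatibility of transposition with the comparison. -/
lemma homEquiv_eqToHom_comp_map {a' : T.A.carrier} {a : S.A.carrier} (f : σ.F.obj a' ⟶ a) :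
    σ.adjX.homEquiv (T.L.obj a') (S.L.obj a)
      (eqToHom (Functor.congr_obj σ.left_comm a').symm ≫ S.L.map f) =
    T.L.map (σ.adjA.homEquiv a' a f) ≫ σ.comparison.app a := by
  have h := Functor.congr_hom σ.left_comm (σ.adjA.homEquiv a' a f)
  rw [comparison_app_eq, ← Adjunction.homEquiv_naturality_left]
  congr 1
  -- It remains to compare the maps before transposition: `f` is `F` of its transpose followed by
  -- the counit, and `L F = F' L'` rewrites `L F` of that transpose as `F' L'` of it.
  have e : σ.F.map (σ.adjA.homEquiv a' a f) ≫ σ.adjA.counit.app a = f :=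
    (σ.adjA.homEquiv_counit ..).symm.trans (Equiv.symm_apply_apply _ _)
  have h' : σ.F'.map (T.L.map (σ.adjA.homEquiv a' a f)) =
      eqToHom (Functor.congr_obj σ.left_comm a').symm ≫
        S.L.map (σ.F.map (σ.adjA.homEquiv a' a f)) ≫
          eqToHom (Functor.congr_obj σ.left_comm (σ.G.obj a)) := by
    have h₂ : S.L.map (σ.F.map (σ.adjA.homEquiv a' a f)) = _ := h
    rw [h₂]
    simp
  conv_lhs => rw [← e]
  rw [h', S.L.map_comp]
  simp

/-- A square from `F' m'` to `m` transposes to a square from `m'` to `G' m`. -/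
lemma transpose_comm_iff {a' : T.A.carrier} {x' : T.X.carrier} (m' : T.L.obj a' ⟶ x')
    {a : S.A.carrier} {x : S.X.carrier} (m : S.L.obj a ⟶ x) (f : σ.F.obj a' ⟶ a)
    (g : σ.F'.obj x' ⟶ x) :
    m' ≫ σ.adjX.homEquiv x' x g =
        T.L.map (σ.adjA.homEquiv a' a f) ≫ σ.comparison.app a ≫ σ.G'.map m ↔
      ((eqToHom σ.left_comm).app a' ≫ σ.F'.map m') ≫ g = S.L.map f ≫ m := by
  -- Both sides become transposes under `F' ⊣ G'`, of `F' m' ≫ g` and of `L f ≫ m` up to `F' L' = L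
  -- F`, and transposition is injective.
  rw [← Category.assoc, ← homEquiv_eqToHom_comp_map, ← Adjunction.homEquiv_naturality_left,
    ← Adjunction.homEquiv_naturality_right, Equiv.apply_eq_iff_eq, eqToHom_app, Category.assoc,
    Category.assoc, ← eqToHom_comp_iff]

lemma transpose_symm_comm {a' : T.A.carrier} {x' : T.X.carrier} (m' : T.L.obj a' ⟶ x')
    {a : S.A.carrier} {x : S.X.carrier} (m : S.L.obj a ⟶ x) (f : a' ⟶ σ.G.obj a)
    (g : x' ⟶ σ.G'.obj x) (w : m' ≫ g = T.L.map f ≫ σ.comparison.app a ≫ σ.G'.map m) :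
    ((eqToHom σ.left_comm).app a' ≫ σ.F'.map m') ≫ (σ.adjX.homEquiv x' x).symm g =
      S.L.map ((σ.adjA.homEquiv a' a).symm f) ≫ m := by
  rw [← transpose_comm_iff, Equiv.apply_symm_apply, Equiv.apply_symm_apply, w]

/-- The componentwise bijection on hom-sets. -/
def thetaHomEquiv (q : StrCsp T.L) (p : StrCsp S.L) :
    (σ.Theta'.obj q ⟶ p) ≃ (q ⟶ σ.Theta.obj p) where
  toFun φ :=
    { f := σ.adjA.homEquiv q.a p.a φ.f
      g := σ.adjX.homEquiv q.x p.x φ.g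
      h := σ.adjA.homEquiv q.b p.b φ.h
      comm_m := (σ.transpose_comm_iff q.m p.m φ.f φ.g).2 φ.comm_m
      comm_n := (σ.transpose_comm_iff q.n p.n φ.h φ.g).2 φ.comm_n }
  invFun ψ :=
    { f := (σ.adjA.homEquiv q.a p.a).symm ψ.f
      g := (σ.adjX.homEquiv q.x p.x).symm ψ.g
      h := (σ.adjA.homEquiv q.b p.b).symm ψ.h
      comm_m := σ.transpose_symm_comm q.m p.m ψ.f ψ.g ψ.comm_m
      comm_n := σ.transpose_symm_comm q.n p.n ψ.h ψ.g ψ.comm_n }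
  left_inv _ := StrCsp.hom_ext (Equiv.symm_apply_apply _ _) (Equiv.symm_apply_apply _ _)
    (Equiv.symm_apply_apply _ _)
  right_inv _ := StrCsp.hom_ext (Equiv.apply_symm_apply _ _) (Equiv.apply_symm_apply _ _)
    (Equiv.apply_symm_apply _ _)

/-- The adjunction `Θ' ⊣ Θ`. -/
def thetaAdj : σ.Theta' ⊣ σ.Theta :=
  Adjunction.mkOfHomEquiv
    { homEquiv := σ.thetaHomEquiv
      homEquiv_naturality_left_symm := fun _ _ => StrCsp.hom_ext
        (Adjunction.homEquiv_naturality_left_symm _ _ _)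
        (Adjunction.homEquiv_naturality_left_symm _ _ _)
        (Adjunction.homEquiv_naturality_left_symm _ _ _)
      homEquiv_naturality_right := fun _ _ => StrCsp.hom_ext
        (Adjunction.homEquiv_naturality_right _ _ _)
        (Adjunction.homEquiv_naturality_right _ _ _)
        (Adjunction.homEquiv_naturality_right _ _ _) }

lemma thetaAdj_homEquiv (q : StrCsp T.L) (p : StrCsp S.L) :
    σ.thetaAdj.homEquiv q p = σ.thetaHomEquiv q p := by
  simp [thetaAdj]

lemma thetaAdj_unit_app (q : StrCsp T.L) :
    σ.thetaAdj.unit.app q = σ.thetaHomEquiv q _ (𝟙 _) := by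
  rw [← thetaAdj_homEquiv, Adjunction.homEquiv_id]

/-- The unit is the transpose of the identity, hence componentwise a unit of `F ⊣ G` or `F' ⊣ G'`.
Functoriality is tested on these components through `AdjTopos.Hom.ext_unit`. -/
lemma thetaAdj_unit_app_f (q : StrCsp T.L) :
    StrCsp.Hom.f (σ.thetaAdj.unit.app q) = σ.adjA.unit.app q.a := by
  rw [thetaAdj_unit_app]
  exact σ.adjA.homEquiv_id q.a

lemma thetaAdj_unit_app_g (q : StrCsp T.L) :
    StrCsp.Hom.g (σ.thetaAdj.unit.app q) = σ.adjX.unit.app q.x := by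
  rw [thetaAdj_unit_app]
  exact σ.adjX.homEquiv_id q.x

lemma thetaAdj_unit_app_h (q : StrCsp T.L) :
    StrCsp.Hom.h (σ.thetaAdj.unit.app q) = σ.adjA.unit.app q.b := by
  rw [thetaAdj_unit_app]
  exact σ.adjA.homEquiv_id q.b

end Adjunction

end ToposAdj.Hom

/-! ### Functoriality -/

section Functoriality

/-- Morphisms of `AdjTopos` are equal if their functors are equal and, along these equalities,
the units agree. -/
lemma AdjTopos.Hom.ext_unit {A B : AdjTopos.{v, u}} {f g : AdjTopos.Hom A B}
    (hl : f.left = g.left) (hr : f.right = g.right)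
    (h : ∀ b, f.adj.unit.app b ≫ eqToHom (by rw [hl, hr]) = g.adj.unit.app b) : f = g := by
  rcases f with ⟨l, r, adj, p⟩
  rcases g with ⟨l', r', adj', p'⟩
  obtain rfl : l = l' := hl
  obtain rfl : r = r' := hr
  congr 1
  ext b
  simpa using h b

namespace StrCsp

variable {A : Type u₁} [Category.{v₁} A] {X : Type u₂} [Category.{v₂} X] {L : A ⥤ X}
  {B : Type u₃} [Category.{v₃} B] {Y : Type u₄} [Category.{v₄} Y] {K : B ⥤ Y}

lemma eqToHom_f {p q : StrCsp L} (h : p = q) :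
    Hom.f (eqToHom h) = eqToHom (congrArg StrCsp.a h) := by
  subst h; rfl

lemma eqToHom_g {p q : StrCsp L} (h : p = q) :
    Hom.g (eqToHom h) = eqToHom (congrArg StrCsp.x h) := by
  subst h; rfl

lemma eqToHom_h {p q : StrCsp L} (h : p = q) :
    Hom.h (eqToHom h) = eqToHom (congrArg StrCsp.b h) := by
  subst h; rfl

lemma comp_eqToHom_eq {p q r : StrCsp L} {s : p ⟶ q} {t : p ⟶ r} (h : q = r)
    (hf : HEq s.f t.f) (hg : HEq s.g t.g) (hh : HEq s.h t.h) : s ≫ eqToHom h = t := by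
  subst h
  rw [eqToHom_refl, Category.comp_id]
  exact hom_ext (eq_of_heq hf) (eq_of_heq hg) (eq_of_heq hh)

/-- The projections determine feet, apices and the action on morphisms but not the legs, hence the
separate condition on objects. -/
lemma functor_ext {C : Type*} [Category C] {H H' : C ⥤ StrCsp K}
    (ho : ∀ c, H.obj c = H'.obj c) (hf : H ⋙ leftFoot K = H' ⋙ leftFoot K)
    (hg : H ⋙ apex K = H' ⋙ apex K) (hh : H ⋙ rightFoot K = H' ⋙ rightFoot K) : H = H' :=
  CategoryTheory.Functor.ext ho fun c d s => hom_ext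
    (by simpa [eqToHom_f] using Functor.congr_hom hf s)
    (by simpa [eqToHom_g] using Functor.congr_hom hg s)
    (by simpa [eqToHom_h] using Functor.congr_hom hh s)

lemma mk_congr {a b : A} {x : X} {m m' : L.obj a ⟶ x} {n n' : L.obj b ⟶ x} (hm : m = m')
    (hn : n = n') : StrCsp.mk a x b m n = StrCsp.mk a x b m' n' := by
  rw [hm, hn]

lemma push_id (α : 𝟭 A ⋙ L ⟶ L ⋙ 𝟭 X) (h : ∀ a, α.app a = 𝟙 (L.obj a)) :
    push (𝟭 A) (𝟭 X) α = 𝟭 (StrCsp L) :=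
  functor_ext (fun p => mk_congr ((h p.a).symm ▸ Category.id_comp p.m)
    ((h p.b).symm ▸ Category.id_comp p.n)) rfl rfl rfl

/-- The condition on `γ` says that it is pasted from `α` and `β`. Feet and apices agree by
definition, so only the legs need it. -/
lemma push_comp {C : Type*} [Category C] {Z : Type*} [Category Z] {M : C ⥤ Z} (P : A ⥤ B)
    (Q : X ⥤ Y) (α : P ⋙ K ⟶ L ⋙ Q) (P' : B ⥤ C) (Q' : Y ⥤ Z) (β : P' ⋙ M ⟶ K ⋙ Q')
    (γ : (P ⋙ P') ⋙ M ⟶ L ⋙ Q ⋙ Q')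
    (h : ∀ a, γ.app a = β.app (P.obj a) ≫ Q'.map (α.app a)) :
    push (P ⋙ P') (Q ⋙ Q') γ = push P Q α ⋙ push P' Q' β := by
  have key : ∀ {a : A} {x : X} (m : L.obj a ⟶ x), γ.app a ≫ (Q ⋙ Q').map m =
      β.app (P.obj a) ≫ Q'.map (α.app a ≫ Q.map m) := fun m => by
    rw [h, Functor.comp_map, Q'.map_comp, Category.assoc]
  exact functor_ext (fun p => mk_congr (key p.m) (key p.n)) rfl rfl rfl

end StrCsp

namespace ToposAdj.Hom

lemma comparison_id (S : ToposAdj.{v, u}) (a : S.A.carrier) :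
    (comparison (𝟙 S)).app a = 𝟙 (S.L.obj a) := by
  rw [comparison_app_eq]
  change Adjunction.id.homEquiv (S.L.obj a) (S.L.obj a) (𝟙 _ ≫ S.L.map (𝟙 a)) = _
  rw [S.L.map_id]
  refine (congrArg _ (Category.comp_id _)).trans ?_
  exact Adjunction.homEquiv_id _ _

/-- Mates paste, because counits and transposition for a composite adjunction are themselves
composites. -/
lemma comparison_comp {S T U : ToposAdj.{v, u}} (σ : S ⟶ T) (τ : T ⟶ U) (a : S.A.carrier) :
    (comparison (σ ≫ τ)).app a =
      (comparison τ).app ((G σ).obj a) ≫ (G' τ).map ((comparison σ).app a) := by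
  -- The counit of the composite at `a` is the inverse transpose of `ε` under the adjunction of `σ`.
  -- Transposing first along `σ` yields `comparison σ`, then along `τ` yields `comparison τ`.
  let c : T.A.carrier := (F τ).obj ((G τ).obj ((G σ).obj a))
  let ε : c ⟶ (G σ).obj a := (adjA τ).counit.app ((G σ).obj a)
  have hτ : (F' τ).obj (U.L.obj ((G τ).obj ((G σ).obj a))) = T.L.obj c :=
    (Functor.congr_obj (left_comm τ) _).symm
  have hσ : (F' σ).obj (T.L.obj c) = S.L.obj ((F σ).obj c) :=
    (Functor.congr_obj (left_comm σ) c).symm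
  have e : eqToHom (Functor.congr_obj (left_comm (σ ≫ τ)) ((G (σ ≫ τ)).obj a)).symm ≫
        S.L.map ((adjA (σ ≫ τ)).counit.app a) =
      (F' σ).map (eqToHom hτ) ≫ eqToHom hσ ≫ S.L.map (((adjA σ).homEquiv c a).symm ε) := by
    have hε : (adjA (σ ≫ τ)).counit.app a = ((adjA σ).homEquiv c a).symm ε :=
      (Adjunction.comp_counit_app (adjA τ) (adjA σ) a).trans
        ((adjA σ).homEquiv_counit ..).symm
    rw [hε, eqToHom_map, eqToHom_trans_assoc]
  have h : (adjX σ).homEquiv (T.L.obj c) (S.L.obj a)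
      (eqToHom hσ ≫ S.L.map (((adjA σ).homEquiv c a).symm ε)) =
        T.L.map ε ≫ (comparison σ).app a := by
    have := homEquiv_eqToHom_comp_map σ (((adjA σ).homEquiv c a).symm ε)
    rwa [Equiv.apply_symm_apply] at this
  have hX : ∀ (y : U.X.carrier) (x : S.X.carrier) (k : (F' σ).obj ((F' τ).obj y) ⟶ x),
      (adjX (σ ≫ τ)).homEquiv y x k =
        (adjX τ).homEquiv y _ ((adjX σ).homEquiv _ x k) := fun y x k =>
    congrFun (congrArg DFunLike.coe (congrFun (congrFun
      (Adjunction.comp_homEquiv (adjX τ) (adjX σ)) y) x)) k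
  rw [comparison_app_eq, e, hX, Adjunction.homEquiv_naturality_left, h, ← Category.assoc,
    Adjunction.homEquiv_naturality_right]
  rfl

lemma theta'_id (S : ToposAdj.{v, u}) : Theta' (𝟙 S) = 𝟭 (StrCsp S.L) :=
  StrCsp.push_id _ fun _ => rfl

lemma theta_id (S : ToposAdj.{v, u}) : Theta (𝟙 S) = 𝟭 (StrCsp S.L) :=
  StrCsp.push_id _ (comparison_id S)

lemma theta_comp {S T U : ToposAdj.{v, u}} (σ : S ⟶ T) (τ : T ⟶ U) :
    Theta (σ ≫ τ) = Theta σ ⋙ Theta τ :=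
  StrCsp.push_comp _ _ _ _ _ _ _ (comparison_comp σ τ)

lemma theta'_comp {S T U : ToposAdj.{v, u}} (σ : S ⟶ T) (τ : T ⟶ U) :
    Theta' (σ ≫ τ) = Theta' τ ⋙ Theta' σ :=
  StrCsp.push_comp _ _ _ _ _ _ _ fun a => by
    rw [eqToHom_app, eqToHom_app, eqToHom_app, eqToHom_map, eqToHom_trans]

lemma thetaAdj_comp_unit_app_f {S T U : ToposAdj.{v, u}} (σ : S ⟶ T) (τ : T ⟶ U)
    (q : StrCsp U.L) :
    StrCsp.Hom.f (((thetaAdj τ).comp (thetaAdj σ)).unit.app q) =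
      (adjA (σ ≫ τ)).unit.app q.a := by
  rw [Adjunction.comp_unit_app]
  exact (congrArg₂ (fun i j => i ≫ (G τ).map j) (thetaAdj_unit_app_f τ q)
    (thetaAdj_unit_app_f σ _)).trans (Adjunction.comp_unit_app (adjA τ) (adjA σ) q.a).symm

lemma thetaAdj_comp_unit_app_g {S T U : ToposAdj.{v, u}} (σ : S ⟶ T) (τ : T ⟶ U)
    (q : StrCsp U.L) :
    StrCsp.Hom.g (((thetaAdj τ).comp (thetaAdj σ)).unit.app q) =
      (adjX (σ ≫ τ)).unit.app q.x := by
  rw [Adjunction.comp_unit_app]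
  exact (congrArg₂ (fun i j => i ≫ (G' τ).map j) (thetaAdj_unit_app_g τ q)
    (thetaAdj_unit_app_g σ _)).trans (Adjunction.comp_unit_app (adjX τ) (adjX σ) q.x).symm

lemma thetaAdj_comp_unit_app_h {S T U : ToposAdj.{v, u}} (σ : S ⟶ T) (τ : T ⟶ U)
    (q : StrCsp U.L) :
    StrCsp.Hom.h (((thetaAdj τ).comp (thetaAdj σ)).unit.app q) =
      (adjA (σ ≫ τ)).unit.app q.b := by
  rw [Adjunction.comp_unit_app]
  exact (congrArg₂ (fun i j => i ≫ (G τ).map j) (thetaAdj_unit_app_h τ q)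
    (thetaAdj_unit_app_h σ _)).trans (Adjunction.comp_unit_app (adjA τ) (adjA σ) q.b).symm

instance theta'_preservesPullbacks {S T : ToposAdj.{v, u}} (σ : Hom S T) :
    PreservesLimitsOfShape WalkingCospan σ.Theta' :=
  haveI := AdjTopos.Hom.preservesPullbacks σ.homA
  haveI := AdjTopos.Hom.preservesPullbacks σ.homX
  haveI := T.A.isTopos.hasFiniteLimits
  haveI := T.X.isTopos.hasFiniteLimits
  StrCsp.push_preservesLimitsOfShape _ _ _

end ToposAdj.Hom

/-- `L ↦ StrCsp L`, given that its values are topoi. -/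
def ToposAdj.strCsp (isTopos : ∀ S : ToposAdj.{v, u}, IsElementaryTopos (StrCsp S.L)) :
    ToposAdj.{v, u} ⥤ AdjTopos.{v, u} where
  obj S := ⟨StrCsp S.L, isTopos S⟩
  map σ := ⟨Hom.Theta' σ, Hom.Theta σ, Hom.thetaAdj σ, Hom.theta'_preservesPullbacks σ⟩
  map_id S := AdjTopos.Hom.ext_unit (Hom.theta'_id S) (Hom.theta_id S) fun _ =>
    StrCsp.comp_eqToHom_eq _
      (heq_of_eq (Hom.thetaAdj_unit_app_f _ _))
      (heq_of_eq (Hom.thetaAdj_unit_app_g _ _))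
      (heq_of_eq (Hom.thetaAdj_unit_app_h _ _))
  map_comp σ τ := AdjTopos.Hom.ext_unit (Hom.theta'_comp σ τ) (Hom.theta_comp σ τ) fun p =>
    StrCsp.comp_eqToHom_eq _
      ((heq_of_eq (Hom.thetaAdj_unit_app_f (σ ≫ τ) p)).trans
        (heq_of_eq (Hom.thetaAdj_comp_unit_app_f σ τ p).symm))
      ((heq_of_eq (Hom.thetaAdj_unit_app_g (σ ≫ τ) p)).trans
        (heq_of_eq (Hom.thetaAdj_comp_unit_app_g σ τ p).symm))
      ((heq_of_eq (Hom.thetaAdj_unit_app_h (σ ≫ τ) p)).trans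
        (heq_of_eq (Hom.thetaAdj_comp_unit_app_h σ τ p).symm))

end Functoriality

/-! ### Exponentials of structured cospans -/

section Exponentials

open MonoidalCategory CartesianMonoidalCategory MonoidalClosed

/-- A couniversal arrow to `d` is a terminal object of the comma category over `d`. Exponentials can
thus be given object by object. -/
lemma CategoryTheory.Functor.isLeftAdjoint_of_couniversal {C : Type u₁} [Category.{v₁} C]
    {D : Type u₂} [Category.{v₂} D] {F : C ⥤ D}
    (h : ∀ d, ∃ (E : C) (ev : F.obj E ⟶ d), ∀ (c : C) (f : F.obj c ⟶ d),
      ∃! k : c ⟶ E, F.map k ≫ ev = f) : F.IsLeftAdjoint := by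
  choose E ev lift hlift huniq using h
  have : ∀ d, HasTerminal (CostructuredArrow F d) := fun d =>
    IsTerminal.hasTerminal (X := CostructuredArrow.mk (ev d)) <| IsTerminal.ofUniqueHom
      (fun f => CostructuredArrow.homMk (lift d f.left f.hom) (hlift d f.left f.hom))
      fun f k => CostructuredArrow.hom_ext _ _ (huniq d f.left f.hom k.left (CostructuredArrow.w k))
  exact isLeftAdjoint_of_costructuredArrowTerminals F

/-- Exponentiability can be checked on any choice of binary products. -/
lemma CategoryTheory.Limits.prod_isLeftAdjoint_of_isLimit {C : Type u₁} [Category.{v₁} C]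
    [HasBinaryProducts C] {p : C} {P : C → C} {π₁ : ∀ t, P t ⟶ p} {π₂ : ∀ t, P t ⟶ t}
    (hP : ∀ t, IsLimit (BinaryFan.mk (π₁ t) (π₂ t))) (map : ∀ {s t : C}, (s ⟶ t) → (P s ⟶ P t))
    (map₁ : ∀ {s t : C} (k : s ⟶ t), map k ≫ π₁ t = π₁ s)
    (map₂ : ∀ {s t : C} (k : s ⟶ t), map k ≫ π₂ t = π₂ s ≫ k)
    (h : ∀ q, ∃ (E : C) (ev : P E ⟶ q), ∀ (t : C) (f : P t ⟶ q),
      ∃! k : t ⟶ E, map k ≫ ev = f) :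
    (prod.functor.obj p).IsLeftAdjoint := by
  refine Functor.isLeftAdjoint_of_couniversal fun q => ?_
  obtain ⟨E, ev, hE⟩ := h q
  -- This comparison of products is natural in `t` (`key`), so the universal property transfers
  -- along it.
  let j : ∀ t, p ⨯ t ≅ P t := fun t =>
    (limit.isLimit (pair p t)).conePointUniqueUpToIso (hP t)
  have j_fst : ∀ t, (j t).hom ≫ π₁ t = prod.fst := fun t =>
    (limit.isLimit (pair p t)).conePointUniqueUpToIso_hom_comp (hP t) ⟨.left⟩
  have j_snd : ∀ t, (j t).hom ≫ π₂ t = prod.snd := fun t =>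
    (limit.isLimit (pair p t)).conePointUniqueUpToIso_hom_comp (hP t) ⟨.right⟩
  have key : ∀ (t : C) (k : t ⟶ E),
      prod.map (𝟙 p) k ≫ (j E).hom = (j t).hom ≫ map k := by
    intro t k
    have h₁ : (prod.map (𝟙 p) k ≫ (j E).hom) ≫ π₁ E = ((j t).hom ≫ map k) ≫ π₁ E := by
      rw [Category.assoc, Category.assoc, map₁, j_fst, j_fst, prod.map_fst, Category.comp_id]
    have h₂ : (prod.map (𝟙 p) k ≫ (j E).hom) ≫ π₂ E = ((j t).hom ≫ map k) ≫ π₂ E := by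
      rw [Category.assoc, Category.assoc, map₂, j_snd, prod.map_snd, ← Category.assoc, j_snd]
    exact BinaryFan.IsLimit.hom_ext (hP E) h₁ h₂
  refine ⟨E, (j E).hom ≫ ev, fun t f => ?_⟩
  have iff : ∀ k : t ⟶ E, (prod.functor.obj p).map k ≫ (j E).hom ≫ ev = f ↔
      map k ≫ ev = (j t).inv ≫ f := fun k => by
    change prod.map (𝟙 p) k ≫ (j E).hom ≫ ev = f ↔ _
    rw [← Category.assoc, key, Category.assoc]
    exact (Iso.eq_inv_comp (j t)).symm
  exact (existsUnique_congr fun k => (iff k)).2 (hE t _)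

variable {A : Type u₁} [Category.{v₁} A] {X : Type u₂} [Category.{v₂} X] {L : A ⥤ X}

/-- One leg of an exponential of structured cospans. -/
lemma exists_exponential_leg [CartesianMonoidalCategory A] [CartesianMonoidalCategory X]
    [HasPullbacks A] {R : X ⥤ A} (adj : L ⊣ R) {a c : A} {x y : X} [Closed a] [Closed x]
    (m : L.obj a ⟶ x) (o : L.obj c ⟶ y) :
    ∃ (E : A) (ε : L.obj E ⟶ (ihom x).obj y) (e : a ⊗ E ⟶ c),
      L.map e ≫ o = lift (L.map (fst a E) ≫ m) (L.map (snd a E) ≫ ε) ≫ (ihom.ev x).app y ∧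
      ∀ (t : A) (w : L.obj t ⟶ (ihom x).obj y) (f : a ⊗ t ⟶ c),
        L.map f ≫ o = lift (L.map (fst a t) ≫ m) (L.map (snd a t) ≫ w) ≫ (ihom.ev x).app y →
        ∃! k : t ⟶ E, L.map k ≫ ε = w ∧ a ◁ k ≫ e = f := by
  -- In terms of elements, `θ` restricts a map `x ⟶ y` along the transpose `a ⟶ R x` of `m`. The
  -- foot `E` is the pullback of `θ` with `c ^ a ⟶ (R y) ^ a`: pairs of maps that agree in `R y`.
  let θ : R.obj ((ihom x).obj y) ⟶ (ihom a).obj (R.obj y) := curry (adj.homEquiv _ _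
    (lift (L.map (fst a _) ≫ m) (L.map (snd a _) ≫ adj.counit.app _) ≫ (ihom.ev x).app y))
  -- Compatibility of `f` with `w`, transposed under currying and `L ⊣ R`, is the cone condition for
  -- that pullback.
  have key : ∀ (t : A) (w : L.obj t ⟶ (ihom x).obj y) (f : a ⊗ t ⟶ c),
      curry f ≫ (ihom a).map (adj.homEquiv c y o) = adj.homEquiv _ _ w ≫ θ ↔
      L.map f ≫ o =
        lift (L.map (fst a t) ≫ m) (L.map (snd a t) ≫ w) ≫ (ihom.ev x).app y := by
    intro t w f
    have hw : L.map (adj.homEquiv _ _ w) ≫ adj.counit.app _ = w :=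
      (adj.homEquiv_counit ..).symm.trans (Equiv.symm_apply_apply _ _)
    rw [← curry_natural_right, ← curry_natural_left, curry_injective.eq_iff,
      ← adj.homEquiv_naturality_left, ← adj.homEquiv_naturality_left, Equiv.apply_eq_iff_eq,
      ← Category.assoc, comp_lift, ← L.map_comp_assoc, ← L.map_comp_assoc, whiskerLeft_fst,
      whiskerLeft_snd, L.map_comp, Category.assoc, hw]
  refine ⟨pullback ((ihom a).map (adj.homEquiv c y o)) θ,
    (adj.homEquiv _ _).symm (pullback.snd _ _), uncurry (pullback.fst _ _), ?_, ?_⟩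
  · rw [← key, curry_uncurry, Equiv.apply_symm_apply, pullback.condition]
  · intro t w f hf
    refine ⟨pullback.lift (curry f) (adj.homEquiv _ _ w) ((key t w f).2 hf), ⟨?_, ?_⟩, ?_⟩
    · rw [← adj.homEquiv_naturality_left_symm, pullback.lift_snd, Equiv.symm_apply_apply]
    · rw [← uncurry_natural_left, pullback.lift_fst, uncurry_curry]
    · rintro k ⟨rfl, rfl⟩
      refine pullback.hom_ext ?_ ?_
      · rw [pullback.lift_fst, curry_natural_left, curry_uncurry]
      · rw [pullback.lift_snd, adj.homEquiv_naturality_left, Equiv.apply_symm_apply]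

namespace StrCsp

/-- The componentwise product of structured cospans. -/
abbrev prodObj [CartesianMonoidalCategory A] [CartesianMonoidalCategory X] (p q : StrCsp L) :
    StrCsp L where
  a := p.a ⊗ q.a
  x := p.x ⊗ q.x
  b := p.b ⊗ q.b
  m := lift (L.map (fst p.a q.a) ≫ p.m) (L.map (snd p.a q.a) ≫ q.m)
  n := lift (L.map (fst p.b q.b) ≫ p.n) (L.map (snd p.b q.b) ≫ q.n)

section

variable [CartesianMonoidalCategory A] [CartesianMonoidalCategory X] {p q t : StrCsp L}

/-- The first projection. -/
abbrev prodFst (p q : StrCsp L) : prodObj p q ⟶ p where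
  f := fst p.a q.a
  g := fst p.x q.x
  h := fst p.b q.b
  comm_m := lift_fst _ _
  comm_n := lift_fst _ _

/-- The second projection. -/
abbrev prodSnd (p q : StrCsp L) : prodObj p q ⟶ q where
  f := snd p.a q.a
  g := snd p.x q.x
  h := snd p.b q.b
  comm_m := lift_snd _ _
  comm_n := lift_snd _ _

/-- The pairing of two morphisms. -/
abbrev prodLift (s : t ⟶ p) (s' : t ⟶ q) : t ⟶ prodObj p q where
  f := lift s.f s'.f
  g := lift s.g s'.g
  h := lift s.h s'.h
  comm_m := by
    rw [comp_lift, comp_lift, ← L.map_comp_assoc, ← L.map_comp_assoc, lift_fst, lift_snd,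
      s.comm_m, s'.comm_m]
  comm_n := by
    rw [comp_lift, comp_lift, ← L.map_comp_assoc, ← L.map_comp_assoc, lift_fst, lift_snd,
      s.comm_n, s'.comm_n]

/-- The componentwise product is a product. -/
def prodIsLimit (p q : StrCsp L) : IsLimit (BinaryFan.mk (prodFst p q) (prodSnd p q)) :=
  BinaryFan.IsLimit.mk _ (fun s s' => prodLift s s')
    (fun _ _ => hom_ext (lift_fst _ _) (lift_fst _ _) (lift_fst _ _))
    (fun _ _ => hom_ext (lift_snd _ _) (lift_snd _ _) (lift_snd _ _))
    (fun _ _ _ h h' => hom_ext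
      (CartesianMonoidalCategory.hom_ext _ _ ((congrArg Hom.f h).trans (lift_fst _ _).symm)
        ((congrArg Hom.f h').trans (lift_snd _ _).symm))
      (CartesianMonoidalCategory.hom_ext _ _ ((congrArg Hom.g h).trans (lift_fst _ _).symm)
        ((congrArg Hom.g h').trans (lift_snd _ _).symm))
      (CartesianMonoidalCategory.hom_ext _ _ ((congrArg Hom.h h).trans (lift_fst _ _).symm)
        ((congrArg Hom.h h').trans (lift_snd _ _).symm)))

/-- Exponentials of structured cospans. -/
lemma exists_exponential [HasPullbacks A] {R : X ⥤ A} (adj : L ⊣ R) (p q : StrCsp L)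
    [Closed p.a] [Closed p.x] [Closed p.b] :
    ∃ (E : StrCsp L) (ev : prodObj p E ⟶ q), ∀ (t : StrCsp L) (f : prodObj p t ⟶ q),
      ∃! k : t ⟶ E, prodLift (prodFst p t) (prodSnd p t ≫ k) ≫ ev = f := by
  obtain ⟨Ea, εa, ea, hea, ua⟩ := exists_exponential_leg adj p.m q.m
  obtain ⟨Eb, εb, eb, heb, ub⟩ := exists_exponential_leg adj p.n q.n
  refine ⟨⟨Ea, (ihom p.x).obj q.x, Eb, εa, εb⟩,
    ⟨ea, (ihom.ev p.x).app q.x, eb, hea.symm, heb.symm⟩, fun t f => ?_⟩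
  have hlift : ∀ {w : X} (r : w ⟶ p.x) (s : w ⟶ t.x) (k : t.x ⟶ (ihom p.x).obj q.x),
      lift r (s ≫ k) ≫ (ihom.ev p.x).app q.x = lift r s ≫ uncurry k := fun r s k => by
    rw [uncurry_eq, lift_whiskerLeft_assoc]
  have whisker : ∀ {u v w : A} (k : v ⟶ w), lift (fst u v) (snd u v ≫ k) = u ◁ k := fun k =>
    CartesianMonoidalCategory.hom_ext _ _ (by simp) (by simp)
  have whisker' : ∀ {u v w : X} (k : v ⟶ w), lift (fst u v) (snd u v ≫ k) = u ◁ k := fun k =>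
    CartesianMonoidalCategory.hom_ext _ _ (by simp) (by simp)
  -- The apex component must be `curry f.g`; this fixes the map `L t.a ⟶ y ^ x` that the foot
  -- component has to induce.
  obtain ⟨ka, ⟨ha, ha'⟩, ua⟩ := ua t.a (t.m ≫ curry f.g) f.f (by
    rw [← Category.assoc, hlift, uncurry_curry]; exact f.comm_m.symm)
  obtain ⟨kb, ⟨hb, hb'⟩, ub⟩ := ub t.b (t.n ≫ curry f.g) f.h (by
    rw [← Category.assoc, hlift, uncurry_curry]; exact f.comm_n.symm)
  refine ⟨⟨ka, curry f.g, kb, ha.symm, hb.symm⟩, hom_ext ?_ ?_ ?_, fun k hk => ?_⟩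
  · exact (congrArg (· ≫ ea) (whisker ka)).trans ha'
  · exact (hlift _ _ _).trans (by rw [uncurry_curry, lift_fst_snd, Category.id_comp])
  · exact (congrArg (· ≫ eb) (whisker kb)).trans hb'
  · have hg : k.g = curry f.g := by
      rw [eq_curry_iff, uncurry_eq, ← whisker']
      exact congrArg Hom.g hk
    refine hom_ext (ua k.f ⟨?_, ?_⟩) hg (ub k.h ⟨?_, ?_⟩)
    · rw [← hg]; exact k.comm_m.symm
    · rw [← whisker]; exact congrArg Hom.f hk
    · rw [← hg]; exact k.comm_n.symm
    · rw [← whisker]; exact congrArg Hom.h hk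

end

lemma prod_isLeftAdjoint [HasFiniteProducts A] [HasPullbacks A] [HasFiniteProducts X]
    [HasBinaryProducts (StrCsp L)]
    (hA : ∀ a : A, (prod.functor.obj a).IsLeftAdjoint)
    (hX : ∀ x : X, (prod.functor.obj x).IsLeftAdjoint) {R : X ⥤ A} (adj : L ⊣ R)
    (p : StrCsp L) : (prod.functor.obj p).IsLeftAdjoint := by
  -- Exponentiability is moved to the monoidal structures given by chosen products, where currying
  -- is available.
  let : CartesianMonoidalCategory A := .ofHasFiniteProducts
  let : CartesianMonoidalCategory X := .ofHasFiniteProducts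
  let closedA : ∀ a : A, Closed a := fun a =>
    haveI := hA a
    haveI := Functor.isLeftAdjoint_of_iso (tensorLeftIsoProd a).symm
    ⟨_, Adjunction.ofIsLeftAdjoint (tensorLeft a)⟩
  let closedX : ∀ x : X, Closed x := fun x =>
    haveI := hX x
    haveI := Functor.isLeftAdjoint_of_iso (tensorLeftIsoProd x).symm
    ⟨_, Adjunction.ofIsLeftAdjoint (tensorLeft x)⟩
  exact prod_isLeftAdjoint_of_isLimit (prodIsLimit p)
    (fun k => prodLift (prodFst p _) (prodSnd p _ ≫ k))
    (fun k => hom_ext (lift_fst _ _) (lift_fst _ _) (lift_fst _ _))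
    (fun k => hom_ext (lift_snd _ _) (lift_snd _ _) (lift_snd _ _))
    (fun q => exists_exponential adj p q)

end StrCsp

end Exponentials

/-! ### The subobject classifier of structured cospans -/

section SubobjectClassifier

variable {A : Type u₁} [Category.{v₁} A] {X : Type u₂} [Category.{v₂} X] {L : A ⥤ X}

/-- One leg of the subobject classifier of structured cospans. -/
lemma exists_classifier_leg [HasFiniteLimits A] {R : X ⥤ A} (adj : L ⊣ R)
    (𝒜 : Subobject.Classifier A) (𝒳 : Subobject.Classifier X) :
    ∃ (W : A) (ω : L.obj W ⟶ 𝒳.Ω) (true' : 𝒜.Ω₀ ⟶ W),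
      L.map true' ≫ ω = 𝒳.χ₀ _ ≫ 𝒳.truth ∧
      ∀ {a' a : A} (i : a' ⟶ a) [Mono i] (ψ : L.obj a ⟶ 𝒳.Ω),
        L.map i ≫ ψ = 𝒳.χ₀ _ ≫ 𝒳.truth →
        ∃! χ : a ⟶ W, L.map χ ≫ ω = ψ ∧ IsPullback i (𝒜.χ₀ a') χ true' := by
  -- `ρ` is truth of `X` seen as a point of `R Ω`. On elements, `κ (u, v)` says that `u` is true and
  -- `v = ρ`, so the equalizer of `κ` and `prod.fst` consists of the pairs for which `u` implies `v
  -- = ρ`.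
  let ρ : 𝒜.Ω₀ ⟶ R.obj 𝒳.Ω := adj.homEquiv _ _ (𝒳.χ₀ _ ≫ 𝒳.truth)
  let P : 𝒜.Ω₀ ⟶ 𝒜.Ω ⨯ R.obj 𝒳.Ω := prod.lift 𝒜.truth ρ
  have : Mono P := 𝒜.isTerminalΩ₀.mono_from P
  let κ := 𝒜.χ P
  have hP : P ≫ κ = P ≫ prod.fst := by
    rw [(𝒜.isPullback P).w, prod.lift_fst, Unique.eq_default (𝒜.χ₀ 𝒜.Ω₀),
      ← Unique.eq_default (𝟙 𝒜.Ω₀), Category.id_comp]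
  let tt : 𝒜.Ω₀ ⟶ equalizer κ prod.fst := equalizer.lift P hP
  have htt : tt ≫ equalizer.ι κ prod.fst = P := equalizer.lift_ι P hP
  -- Since the inclusion of the equalizer is monic, pullbacks of `tt` can be tested as pullbacks of
  -- `P`.
  have hι : IsPullback tt (𝟙 _) (equalizer.ι κ prod.fst) P :=
    IsPullback.of_vert_isIso_mono ⟨by rw [htt, Category.id_comp]⟩
  refine ⟨equalizer κ prod.fst, (adj.homEquiv _ _).symm (equalizer.ι κ prod.fst ≫ prod.snd), tt,
    ?_, fun {a' a} i _ ψ hψ => ?_⟩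
  · rw [← adj.homEquiv_naturality_left_symm, ← Category.assoc, htt, prod.lift_snd,
      Equiv.symm_apply_apply]
  · have key : ∀ {v : a ⟶ 𝒜.Ω ⨯ R.obj 𝒳.Ω} {l : a' ⟶ 𝒜.Ω₀}, IsPullback i l v P →
        v ≫ κ = 𝒜.χ i := fun h => 𝒜.uniq i (h.paste_vert (𝒜.isPullback P))
    let v : a ⟶ 𝒜.Ω ⨯ R.obj 𝒳.Ω := prod.lift (𝒜.χ i) (adj.homEquiv _ _ ψ)
    -- The second coordinate adds no condition: by `hψ` it already equals `ρ` on `a'`.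
    have hv : IsPullback i (𝒜.χ₀ a') v P := by
      have w : i ≫ v = 𝒜.χ₀ a' ≫ P := by
        refine prod.hom_ext ?_ ?_
        · rw [Category.assoc, Category.assoc, prod.lift_fst, prod.lift_fst, (𝒜.isPullback i).w]
        · rw [Category.assoc, Category.assoc, prod.lift_snd, prod.lift_snd,
            ← adj.homEquiv_naturality_left, ← adj.homEquiv_naturality_left, hψ, ← Category.assoc,
            Subsingleton.elim (L.map (𝒜.χ₀ a') ≫ 𝒳.χ₀ _) (𝒳.χ₀ _)]
      refine ⟨⟨w⟩, ⟨PullbackCone.IsLimit.mk w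
        (fun s => (𝒜.isPullback i).lift s.fst s.snd ?_) (fun s => ?_) (fun s => ?_)
        (fun s k hk _ => ?_)⟩⟩
      · have := s.condition =≫ prod.fst
        rwa [Category.assoc, Category.assoc, prod.lift_fst, prod.lift_fst] at this
      · exact (𝒜.isPullback i).lift_fst _ _ _
      · exact Subsingleton.elim _ _
      · rw [← cancel_mono i, hk, (𝒜.isPullback i).lift_fst]
    -- Both composites classify `i`, so `v` factors through the equalizer.
    have hvκ : v ≫ κ = v ≫ prod.fst := by rw [key hv, prod.lift_fst]
    have hχ : equalizer.lift v hvκ ≫ equalizer.ι κ prod.fst = v := equalizer.lift_ι v hvκ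
    refine ⟨equalizer.lift v hvκ, ⟨?_, ?_⟩, ?_⟩
    · rw [← adj.homEquiv_naturality_left_symm, ← Category.assoc, hχ, prod.lift_snd,
        Equiv.symm_apply_apply]
    · refine IsPullback.of_bot (v₂₁ := 𝟙 _) (by rwa [Category.comp_id, hχ]) ?_ hι
      rw [← cancel_mono (equalizer.ι κ prod.fst), Category.assoc, Category.assoc, hχ, htt, hv.w]
    · rintro χ ⟨rfl, hχ'⟩
      refine equalizer.hom_ext (prod.hom_ext ?_ ?_)
      -- By the equalizer condition, the first coordinate of a competing map is its composite with
      -- `κ`, which classifies `i`.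
      · rw [hχ, prod.lift_fst, ← key (hχ'.paste_vert hι), Category.assoc, Category.assoc,
          equalizer.condition]
      · rw [hχ, prod.lift_snd, ← adj.homEquiv_naturality_left_symm, Equiv.apply_symm_apply,
          Category.assoc]

namespace StrCsp

lemma isPullback_of_components {p q r s : StrCsp L} {t : p ⟶ q} {l : p ⟶ r} {k : q ⟶ s}
    {b : r ⟶ s} (hf : IsPullback t.f l.f k.f b.f) (hg : IsPullback t.g l.g k.g b.g)
    (hh : IsPullback t.h l.h k.h b.h) : IsPullback t l k b := by
  have w : t ≫ k = l ≫ b := hom_ext hf.w hg.w hh.w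
  refine ⟨⟨w⟩, ⟨PullbackCone.IsLimit.mk w (fun c =>
    { f := hf.lift c.fst.f c.snd.f (congrArg Hom.f c.condition)
      g := hg.lift c.fst.g c.snd.g (congrArg Hom.g c.condition)
      h := hh.lift c.fst.h c.snd.h (congrArg Hom.h c.condition)
      comm_m := hg.hom_ext ?_ ?_
      comm_n := hg.hom_ext ?_ ?_ }) (fun c => ?_) (fun c => ?_) (fun c j h₁ h₂ => ?_)⟩⟩
  · rw [Category.assoc, Category.assoc, hg.lift_fst, t.comm_m, ← L.map_comp_assoc, hf.lift_fst,
      c.fst.comm_m]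
  · rw [Category.assoc, Category.assoc, hg.lift_snd, l.comm_m, ← L.map_comp_assoc, hf.lift_snd,
      c.snd.comm_m]
  · rw [Category.assoc, Category.assoc, hg.lift_fst, t.comm_n, ← L.map_comp_assoc, hh.lift_fst,
      c.fst.comm_n]
  · rw [Category.assoc, Category.assoc, hg.lift_snd, l.comm_n, ← L.map_comp_assoc, hh.lift_snd,
      c.snd.comm_n]
  · exact hom_ext (hf.lift_fst _ _ _) (hg.lift_fst _ _ _) (hh.lift_fst _ _ _)
  · exact hom_ext (hf.lift_snd _ _ _) (hg.lift_snd _ _ _) (hh.lift_snd _ _ _)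
  · refine hom_ext (hf.hom_ext ?_ ?_) (hg.hom_ext ?_ ?_) (hh.hom_ext ?_ ?_)
    · exact (congrArg Hom.f h₁).trans (hf.lift_fst _ _ _).symm
    · exact (congrArg Hom.f h₂).trans (hf.lift_snd _ _ _).symm
    · exact (congrArg Hom.g h₁).trans (hg.lift_fst _ _ _).symm
    · exact (congrArg Hom.g h₂).trans (hg.lift_snd _ _ _).symm
    · exact (congrArg Hom.h h₁).trans (hh.lift_fst _ _ _).symm
    · exact (congrArg Hom.h h₂).trans (hh.lift_snd _ _ _).symm

/-- A subobject has three monic components. The classifying map of its apex, precomposed with a leg,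
is true on the corresponding subfoot, so `exists_classifier_leg` gives a unique foot component; the
same `W` serves both feet. -/
lemma hasSubobjectClassifier [HasFiniteLimits A] [HasFiniteLimits X]
    [HasSubobjectClassifier A] [HasSubobjectClassifier X] {R : X ⥤ A} (adj : L ⊣ R) :
    HasSubobjectClassifier (StrCsp L) := by
  obtain ⟨𝒜⟩ := HasSubobjectClassifier.exists_classifier (C := A)
  obtain ⟨𝒳⟩ := HasSubobjectClassifier.exists_classifier (C := X)
  obtain ⟨W, ω, tt, htt, hW⟩ := exists_classifier_leg adj 𝒜 𝒳
  let one : StrCsp L := ⟨𝒜.Ω₀, 𝒳.Ω₀, 𝒜.Ω₀, 𝒳.χ₀ _, 𝒳.χ₀ _⟩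
  let Ω : StrCsp L := ⟨W, 𝒳.Ω, W, ω, ω⟩
  let truth : one ⟶ Ω := ⟨tt, 𝒳.truth, tt, htt.symm, htt.symm⟩
  have term : IsTerminal one := IsTerminal.ofUniqueHom
    (fun p => ⟨𝒜.χ₀ _, 𝒳.χ₀ _, 𝒜.χ₀ _, Subsingleton.elim _ _, Subsingleton.elim _ _⟩)
    (fun p k => hom_ext (Unique.eq_default (α := p.a ⟶ 𝒜.Ω₀) k.f)
      (Unique.eq_default (α := p.x ⟶ 𝒳.Ω₀) k.g) (Unique.eq_default (α := p.b ⟶ 𝒜.Ω₀) k.h))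
  have main : ∀ {U p : StrCsp L} (s : U ⟶ p) [Mono s],
      ∃! χ : p ⟶ Ω, IsPullback s (term.from U) χ truth := by
    intro U p s _
    have : Mono s.f := (leftFoot L).map_mono s
    have : Mono s.g := (apex L).map_mono s
    have : Mono s.h := (rightFoot L).map_mono s
    have hχ : s.g ≫ 𝒳.χ s.g = 𝒳.χ₀ _ ≫ 𝒳.truth := (𝒳.isPullback s.g).w
    obtain ⟨χa, ⟨ha, ha'⟩, ua⟩ := hW s.f (p.m ≫ 𝒳.χ s.g) (by
      rw [← Category.assoc, ← s.comm_m, Category.assoc, hχ, ← Category.assoc,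
        Subsingleton.elim (U.m ≫ 𝒳.χ₀ _) (𝒳.χ₀ _)])
    obtain ⟨χb, ⟨hb, hb'⟩, ub⟩ := hW s.h (p.n ≫ 𝒳.χ s.g) (by
      rw [← Category.assoc, ← s.comm_n, Category.assoc, hχ, ← Category.assoc,
        Subsingleton.elim (U.n ≫ 𝒳.χ₀ _) (𝒳.χ₀ _)])
    have hf : (term.from U).f = 𝒜.χ₀ U.a := Subsingleton.elim (α := U.a ⟶ 𝒜.Ω₀) _ _
    have hh : (term.from U).h = 𝒜.χ₀ U.b := Subsingleton.elim (α := U.b ⟶ 𝒜.Ω₀) _ _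
    have hg : (term.from U).g = 𝒳.χ₀ U.x := Subsingleton.elim (α := U.x ⟶ 𝒳.Ω₀) _ _
    refine ⟨⟨χa, 𝒳.χ s.g, χb, ha.symm, hb.symm⟩, isPullback_of_components ?_ ?_ ?_,
      fun k hk => ?_⟩
    · rwa [hf]
    · rw [hg]; exact 𝒳.isPullback s.g
    · rwa [hh]
    · have kg : k.g = 𝒳.χ s.g := 𝒳.uniq s.g (hk.map (apex L))
      refine hom_ext (ua k.f ⟨?_, ?_⟩) kg (ub k.h ⟨?_, ?_⟩)
      · rw [← kg]; exact k.comm_m.symm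
      · rw [← hf]; exact hk.map (leftFoot L)
      · rw [← kg]; exact k.comm_n.symm
      · rw [← hh]; exact hk.map (rightFoot L)
  choose χ hχ uχ using @main
  exact ⟨⟨Subobject.Classifier.mkOfTerminalΩ₀ one term Ω truth χ hχ fun s _ χ' h => uχ s χ' h⟩⟩

end StrCsp

end SubobjectClassifier

lemma ToposAdj.isElementaryTopos_strCsp (S : ToposAdj.{v, u}) :
    IsElementaryTopos (StrCsp S.L) :=
  haveI := S.A.isTopos.hasFiniteLimits
  haveI := S.X.isTopos.hasFiniteLimits
  haveI := S.A.isTopos.hasClassifier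
  haveI := S.X.isTopos.hasClassifier
  { hasFiniteLimits := ⟨fun _ _ _ => inferInstance⟩
    cartesianClosed := StrCsp.prod_isLeftAdjoint S.A.isTopos.cartesianClosed
      S.X.isTopos.cartesianClosed S.hom.adj
    hasClassifier := StrCsp.hasSubobjectClassifier S.hom.adj }

/-- `L ↦ StrCsp L` is a functor from the arrow category of `AdjTopos` to `AdjTopos`. It sends a
morphism `(F ⊣ G, F' ⊣ G')` to an adjunction `Θ' ⊣ Θ` which is, on hom-sets, given componentwise
by the adjunctions `F ⊣ G`, `F' ⊣ G'`, `F ⊣ G`. -/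
theorem mainTheorem3 :
    ∃ (isTopos : ∀ S : ToposAdj.{v, u}, IsElementaryTopos (StrCsp S.L))
      (adj : ∀ {S T : ToposAdj.{v, u}} (σ : S ⟶ T),
        ToposAdj.Hom.Theta' σ ⊣ ToposAdj.Hom.Theta σ)
      (pres : ∀ {S T : ToposAdj.{v, u}} (σ : S ⟶ T),
        PreservesLimitsOfShape WalkingCospan (ToposAdj.Hom.Theta' σ)),
      (∀ {S T : ToposAdj.{v, u}} (σ : S ⟶ T) (q : StrCsp T.L) (p : StrCsp S.L)
        (φ : (ToposAdj.Hom.Theta' σ).obj q ⟶ p),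
          ((adj σ).homEquiv q p φ).f = (ToposAdj.Hom.adjA σ).homEquiv q.a p.a φ.f ∧
          ((adj σ).homEquiv q p φ).g = (ToposAdj.Hom.adjX σ).homEquiv q.x p.x φ.g ∧
          ((adj σ).homEquiv q p φ).h = (ToposAdj.Hom.adjA σ).homEquiv q.b p.b φ.h) ∧
      (∃ Φ : ToposAdj.{v, u} ⥤ AdjTopos.{v, u},
        Φ.toPrefunctor =
          { obj := fun S => ⟨StrCsp S.L, isTopos S⟩
            map := fun σ =>
              ⟨ToposAdj.Hom.Theta' σ, ToposAdj.Hom.Theta σ, adj σ, pres σ⟩ }) ∧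
      (∃ Ψ : Arrow AdjTopos.{v, u} ⥤ AdjTopos.{v, u},
        Ψ.toPrefunctor =
          { obj := fun f => ⟨StrCsp (ToposAdj.ofArrow.obj f).L, isTopos _⟩
            map := fun s =>
              ⟨ToposAdj.Hom.Theta' (ToposAdj.ofArrow.map s),
                ToposAdj.Hom.Theta (ToposAdj.ofArrow.map s), adj _, pres _⟩ }) := by
  refine ⟨ToposAdj.isElementaryTopos_strCsp, ToposAdj.Hom.thetaAdj,
    ToposAdj.Hom.theta'_preservesPullbacks, fun σ q p φ => ?_,
    ⟨ToposAdj.strCsp ToposAdj.isElementaryTopos_strCsp, rfl⟩,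
    ⟨ToposAdj.ofArrow ⋙ ToposAdj.strCsp ToposAdj.isElementaryTopos_strCsp, rfl⟩⟩
  rw [ToposAdj.Hom.thetaAdj_homEquiv]
  exact ⟨rfl, rfl, rfl⟩
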